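/- Let $K$ be a field. For a finite quiver $\mathcal Q$ (finitely many vertices and arrows), let $K\mathcal Q$ be its path algebra and $J$ the two-sided ideal of $K\mathcal Q$ generated by the arrows. A two-sided ideal $I$ of $K\mathcal Q$ is admissible if $J^n\subseteq I\subseteq J^2$ for some $n\ge 2$. The quiver $\mathcal Q$ is path connected if for every pair of vertices $v,w$ there are a directed path (possibly of length $0$) from $v$ to $w$ and one from $w$ to $v$. The finitistic dimension of an algebra is the supremum of the projective dimensions of its finitely generated right modules of finite projective dimension. Theorem. Suppose that the algebra $K\mathcal Q/I$ has finite finitistic dimension for every finite path connected quiver $\mathcal Q$ and every admissible ideal $I$ of $K\mathcal Q$. Then the algebra $K\mathcal Q/I$ has finite finitistic dimension for every finite quiver $\mathcal Q$ and every admissible ideal $I$ of $K\mathcal Q$. -/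

import Mathlib

open Quiver CategoryTheory

universe u v w

noncomputable section

/-- The paths of a quiver `V`, with all possible origins and termini
(the trivial path at each vertex included). -/
abbrev Quiver.TotalPath (V : Type v) [Quiver.{w} V] : Type (max v w) :=
  Σ a b : V, Path a b

/-- The path algebra of `V` over `K`, as a vector space: the space with basis the paths of `V`. -/
def PathAlgebra (K : Type u) [Field K] (V : Type v) [Quiver.{w} V] : Type (max u v w) :=
  TotalPath V →₀ K

namespace PathAlgebra

variable (K : Type u) [Field K] {V : Type v} [Quiver.{w} V]

instance : AddCommGroup (PathAlgebra K V) :=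
  inferInstanceAs (AddCommGroup (TotalPath V →₀ K))

instance : Module K (PathAlgebra K V) :=
  inferInstanceAs (Module K (TotalPath V →₀ K))

/-- The basis element of the path algebra given by a path. -/
def ofPath {a b : V} (p : Path a b) : PathAlgebra K V :=
  (Finsupp.single (⟨a, b, p⟩ : TotalPath V) (1 : K) : TotalPath V →₀ K)

open Classical in
/-- The product of two paths: the concatenation `pq` (first `p`, then `q`) if `p` ends where `q`
starts, and `0` otherwise. -/
def pathMul (p q : TotalPath V) : PathAlgebra K V :=
  if h : q.1 = p.2.1 then ofPath K (p.2.2.comp (q.2.2.cast h rfl)) else 0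

/-- The multiplication of the path algebra: the bilinear extension of the product of paths. -/
def mulLin : PathAlgebra K V →ₗ[K] PathAlgebra K V →ₗ[K] PathAlgebra K V :=
  Finsupp.linearCombination K fun p : TotalPath V =>
    (Finsupp.linearCombination K fun q : TotalPath V => pathMul K p q :
      (TotalPath V →₀ K) →ₗ[K] PathAlgebra K V)

instance : Mul (PathAlgebra K V) := ⟨fun x y => mulLin K x y⟩

/-- The identity of the path algebra: the sum of the trivial paths at the vertices. -/
instance [Fintype V] : One (PathAlgebra K V) := ⟨∑ a : V, ofPath K (Path.nil : Path a a)⟩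

theorem mul_def (x y : PathAlgebra K V) : x * y = mulLin K x y := rfl

theorem one_def [Fintype V] :
    (1 : PathAlgebra K V) = ∑ a : V, ofPath K (Path.nil : Path a a) := rfl

theorem mulLin_ofPath {a b c d : V} (p : Path a b) (q : Path c d) :
    mulLin K (ofPath K p) (ofPath K q) = pathMul K ⟨a, b, p⟩ ⟨c, d, q⟩ := by
  have h : mulLin K (ofPath K p) = (1 : K) • (Finsupp.linearCombination K fun q : TotalPath V =>
      pathMul K ⟨a, b, p⟩ q : (TotalPath V →₀ K) →ₗ[K] PathAlgebra K V) :=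
    Finsupp.linearCombination_single K _ _
  rw [h, one_smul]
  exact (Finsupp.linearCombination_single K _ _).trans (one_smul _ _)

theorem ofPath_mul_ofPath {a b c : V} (p : Path a b) (q : Path b c) :
    ofPath K p * ofPath K q = ofPath K (p.comp q) := by
  rw [mul_def, mulLin_ofPath]
  simp [pathMul]

theorem ofPath_mul_ofPath_of_ne {a b c d : V} (p : Path a b) (q : Path c d) (h : b ≠ c) :
    ofPath K p * ofPath K q = 0 := by
  rw [mul_def, mulLin_ofPath]
  simp [pathMul, h.symm]

variable {K} in
/-- An additive property of elements that holds for the multiples of paths always holds. -/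
theorem induction {P : PathAlgebra K V → Prop} (x : PathAlgebra K V) (zero : P 0)
    (add : ∀ x y, P x → P y → P (x + y))
    (smul : ∀ (k : K) (a b : V) (p : Path a b), P (k • ofPath K p)) : P x := by
  refine Finsupp.induction_linear (motive := P) x zero (fun f g => add f g) ?_
  rintro ⟨a, b, p⟩ k
  have h := smul k a b p
  have e : k • ofPath K p =
      (Finsupp.single (⟨a, b, p⟩ : TotalPath V) k : TotalPath V →₀ K) :=
    (Finsupp.smul_single k _ (1 : K)).trans (by simp)
  rwa [e] at h

instance : NonUnitalNonAssocRing (PathAlgebra K V) where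
  left_distrib x y z := map_add (mulLin K x) y z
  right_distrib x y z := by simp only [mul_def, map_add, LinearMap.add_apply]
  zero_mul x := by simp only [mul_def, map_zero, LinearMap.zero_apply]
  mul_zero x := map_zero (mulLin K x)

theorem smul_mul (k : K) (x y : PathAlgebra K V) : (k • x) * y = k • (x * y) := by
  simp only [mul_def, map_smul, LinearMap.smul_apply]

theorem mul_smul' (k : K) (x y : PathAlgebra K V) : x * (k • y) = k • (x * y) :=
  map_smul (mulLin K x) k y

theorem ofPath_mul_assoc {a b c d e f : V} (p : Path a b) (q : Path c d) (r : Path e f) :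
    ofPath K p * ofPath K q * ofPath K r = ofPath K p * (ofPath K q * ofPath K r) := by
  by_cases h₁ : b = c
  · subst h₁
    by_cases h₂ : d = e
    · subst h₂
      simp only [ofPath_mul_ofPath, Path.comp_assoc]
    · rw [ofPath_mul_ofPath, ofPath_mul_ofPath_of_ne K _ r h₂, ofPath_mul_ofPath_of_ne K _ r h₂,
        mul_zero]
  · rw [ofPath_mul_ofPath_of_ne K p q h₁, zero_mul]
    by_cases h₂ : d = e
    · subst h₂
      rw [ofPath_mul_ofPath, ofPath_mul_ofPath_of_ne K p _ h₁]
    · rw [ofPath_mul_ofPath_of_ne K _ r h₂, mul_zero]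

protected theorem mul_assoc (x y z : PathAlgebra K V) : x * y * z = x * (y * z) := by
  induction x using PathAlgebra.induction with
  | zero => simp
  | add x x' hx hx' => rw [add_mul, add_mul, add_mul, hx, hx']
  | smul k a b p =>
  induction y using PathAlgebra.induction with
  | zero => simp
  | add y y' hy hy' => rw [mul_add, add_mul, add_mul, mul_add, hy, hy']
  | smul l c d q =>
  induction z using PathAlgebra.induction with
  | zero => simp
  | add z z' hz hz' => rw [mul_add, mul_add, mul_add, hz, hz']
  | smul m e f r =>
  simp only [smul_mul, mul_smul', ofPath_mul_assoc]

protected theorem one_mul [Fintype V] (x : PathAlgebra K V) : 1 * x = x := by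
  induction x using PathAlgebra.induction with
  | zero => simp
  | add x x' hx hx' => rw [mul_add, hx, hx']
  | smul k a b p =>
  rw [mul_smul', one_def, Finset.sum_mul, Finset.sum_eq_single a, ofPath_mul_ofPath,
    Path.nil_comp]
  · intro c _ hc
    exact ofPath_mul_ofPath_of_ne K _ p hc
  · simp

protected theorem mul_one [Fintype V] (x : PathAlgebra K V) : x * 1 = x := by
  induction x using PathAlgebra.induction with
  | zero => simp
  | add x x' hx hx' => rw [add_mul, hx, hx']
  | smul k a b p =>
  rw [smul_mul, one_def, Finset.mul_sum, Finset.sum_eq_single b, ofPath_mul_ofPath,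
    Path.comp_nil]
  · intro c _ hc
    exact ofPath_mul_ofPath_of_ne K p _ hc.symm
  · simp

instance [Fintype V] : Ring (PathAlgebra K V) :=
  { (inferInstance : NonUnitalNonAssocRing (PathAlgebra K V)) with
    mul_assoc := PathAlgebra.mul_assoc K
    one_mul := PathAlgebra.one_mul K
    mul_one := PathAlgebra.mul_one K }

instance [Fintype V] : Algebra K (PathAlgebra K V) :=
  Algebra.ofModule (smul_mul K) (mul_smul' K)

variable (V) in
/-- The two-sided ideal `J` of the path algebra generated by the arrows. -/
def arrowIdeal [Fintype V] : Ideal (PathAlgebra K V) :=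
  (TwoSidedIdeal.span
    {x : PathAlgebra K V | ∃ (a b : V) (e : a ⟶ b), x = ofPath K e.toPath}).asIdeal

variable {K} in
/-- An ideal `I` is admissible if `J ^ n ⊆ I ⊆ J ^ 2` for some `n ≥ 2`. -/
def IsAdmissible [Fintype V] (I : Ideal (PathAlgebra K V)) : Prop :=
  ∃ n : ℕ, 2 ≤ n ∧ arrowIdeal K V ^ n ≤ I ∧ I ≤ arrowIdeal K V ^ 2

end PathAlgebra

/-- The (little) finitistic dimension of a ring: the supremum of the projective dimensions of the
finitely generated right modules of finite projective dimension. Right `R`-modules are modules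
over the opposite ring. -/
def finitisticDimension (R : Type u) [Ring R] : WithBot ℕ∞ :=
  ⨆ (M : ModuleCat.{u} Rᵐᵒᵖ) (_ : Module.Finite Rᵐᵒᵖ M) (_ : projectiveDimension M ≠ ⊤),
    projectiveDimension M

end

/-! Induct on the number of vertices. If the quiver is not path connected, some vertex `b` is
unreachable from some vertex `a`. The set `U` of vertices reachable from `a` and its complement are
both proper, and no path leads from `U` to the complement. So the bound path algebra is triangular,
its corners are the bound path algebras of the two full subquivers, and it suffices to bound the
finitistic dimension of a triangular ring by those of its corners (`FinitisticBound.triangular`).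

Let `R` be the opposite algebra, with `e + f = 1` and `f R e = 0`, so that `R e = e R e` and `f R =
f R f`. Since `f R` is free over the corner at `f`, passing from `M` to `f M` does not increase
projective dimension (`hasProjectiveDimensionLT_peircePart`). A bounded number of syzygies therefore
makes `f M` projective. Then `M` is covered by the sum of a projective agreeing with `M` on
`f`-parts (`exists_projective_lift`) and a projective `(R e) ^ l`. The kernel is fixed by `e`, so
its projective dimension may be computed over the corner at `e`
(`hasProjectiveDimensionLT_peircePart_iff`), where it is bounded. -/

noncomputable section

/-! ### Peirce parts and projective dimension -/

/-- The part `e • M` of a module `M` cut out by the idempotent `e = s 1`, where `s` identifies a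
ring `B` with a corner of `R`. -/
def peircePart {B R : Type u} [Ring B] [Ring R] (s : B →ₙ+* R) (M : Type u) [AddCommGroup M]
    [Module R M] : AddSubgroup M where
  carrier := {m | s 1 • m = m}
  zero_mem' := smul_zero _
  add_mem' {a b} ha hb := by
    simp only [Set.mem_ofPred_eq] at *
    rw [smul_add, ha, hb]
  neg_mem' {a} ha := by
    simp only [Set.mem_ofPred_eq] at *
    rw [smul_neg, ha]

section Peirce

variable {B R : Type u} [Ring B] [Ring R] (s : B →ₙ+* R)
  {M : Type u} [AddCommGroup M] [Module R M] {N : Type u} [AddCommGroup N] [Module R N]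

theorem mem_peircePart {m : M} : m ∈ peircePart s M ↔ s 1 • m = m := Iff.rfl

theorem smul_mem_peircePart (b : B) (m : M) : s b • m ∈ peircePart s M := by
  rw [mem_peircePart, smul_smul, ← map_mul, one_mul]

instance : SMul B (peircePart s M) := ⟨fun b m => ⟨s b • m.1, smul_mem_peircePart s b m.1⟩⟩

theorem coe_smul_peircePart (b : B) (m : peircePart s M) :
    ((b • m : peircePart s M) : M) = s b • (m : M) := rfl

instance : Module B (peircePart s M) where
  one_smul m := Subtype.ext m.2
  mul_smul a b m := Subtype.ext (by simp only [coe_smul_peircePart, map_mul, mul_smul])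
  smul_zero a := Subtype.ext (by simp [coe_smul_peircePart])
  smul_add a m n := Subtype.ext (by simp [coe_smul_peircePart])
  add_smul a b m := Subtype.ext (by simp [coe_smul_peircePart, add_smul])
  zero_smul m := Subtype.ext (by simp [coe_smul_peircePart])

/-- The map induced by a linear map on Peirce parts. -/
def peirceMap (f : M →ₗ[R] N) : peircePart s M →ₗ[B] peircePart s N where
  toFun m := ⟨f m.1, by rw [mem_peircePart, ← map_smul, (mem_peircePart s).1 m.2]⟩
  map_add' m n := Subtype.ext (map_add f _ _)
  map_smul' b m := Subtype.ext (map_smul f _ _)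

theorem coe_peirceMap (f : M →ₗ[R] N) (m : peircePart s M) :
    (peirceMap s f m : N) = f m := rfl

theorem peirceMap_surjective (f : M →ₗ[R] N) (hf : Function.Surjective f) :
    Function.Surjective (peirceMap s f) := by
  rintro ⟨n, hn⟩
  obtain ⟨m, rfl⟩ := hf n
  refine ⟨⟨s 1 • m, smul_mem_peircePart s 1 m⟩, Subtype.ext ?_⟩
  rw [coe_peirceMap, map_smul]
  exact hn

/-- Taking Peirce parts commutes with kernels. -/
def peirceKer (f : M →ₗ[R] N) :
    LinearMap.ker (peirceMap s f) ≃ₗ[B] peircePart s (LinearMap.ker f) where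
  toFun m := ⟨⟨m.1.1, congrArg Subtype.val m.2⟩, Subtype.ext m.1.2⟩
  invFun m := ⟨⟨m.1.1, congrArg Subtype.val m.2⟩, Subtype.ext m.1.2⟩
  left_inv _ := rfl
  right_inv _ := rfl
  map_add' _ _ := rfl
  map_smul' _ _ := rfl

theorem hasProjectiveDimensionLT_congr (e : M ≃ₗ[R] N) (n : ℕ)
    (h : HasProjectiveDimensionLT (ModuleCat.of R M) n) :
    HasProjectiveDimensionLT (ModuleCat.of R N) n :=
  hasProjectiveDimensionLT_of_iso e.toModuleIso n

theorem hasProjectiveDimensionLT_one_iff :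
    HasProjectiveDimensionLT (ModuleCat.of R M) 1 ↔ Module.Projective R M := by
  rw [← projective_iff_hasProjectiveDimensionLT_one, IsProjective.iff_projective]

/-- Dimension shift. The indices start at 2 and 1 because one step lower it would say that `N` is
projective only when the kernel vanishes. -/
theorem hasProjectiveDimensionLT_iff_ker [Module.Projective R M] (f : M →ₗ[R] N)
    (hf : Function.Surjective f) (n : ℕ) :
    HasProjectiveDimensionLT (ModuleCat.of R N) (n + 2) ↔
      HasProjectiveDimensionLT (ModuleCat.of R (LinearMap.ker f)) (n + 1) :=
  (LinearMap.shortExact_shortComplexKer hf).hasProjectiveDimensionLT_X₃_iff n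
    ((ModuleCat.of R M).projective_of_categoryTheory_projective)

/-- If `m = ∑ r_j m_j`, then `e m = ∑ (e r_j e) (e m_j)`, so the `e m_j` generate. The condition
`hM` covers both `e R = e R e` and modules on which `e` is the identity. -/
theorem finite_peircePart (hs : ∀ r, ∃ b, s b = s 1 * r * s 1)
    (hM : ∀ (r : R) (m : M), s 1 • r • m = s 1 • r • s 1 • m) [Module.Finite R M] :
    Module.Finite B (peircePart s M) := by
  obtain ⟨n, f, hf⟩ := Module.Finite.exists_fin' R M
  let x : Fin n → peircePart s M := fun j =>
    ⟨s 1 • f (Pi.single j 1), smul_mem_peircePart s 1 _⟩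
  refine Module.Finite.of_surjective (Fintype.linearCombination B x) ?_
  rintro ⟨y, hy⟩
  obtain ⟨r, rfl⟩ := hf y
  choose b hb using fun j => hs (r j)
  refine ⟨b, Subtype.ext ?_⟩
  rw [mem_peircePart] at hy
  have hr : f r = ∑ j, r j • f (Pi.single j 1) := by
    conv_lhs => rw [pi_eq_sum_univ' r]
    simp [map_sum]
  rw [Fintype.linearCombination_apply, AddSubgroup.val_finsetSum]
  simp only [coe_smul_peircePart, x, hb]
  conv_rhs => rw [← hy, hr, Finset.smul_sum]
  refine Finset.sum_congr rfl fun j _ => ?_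
  rw [hM, mul_smul, mul_smul, smul_smul (s 1) (s 1), ← map_mul, one_mul]

/-- The hypotheses make `i` identify `e • M` with `(e R e) ^ n`, which is free over `B`. This treats
`R ^ n` (when `e R = e R e`) and `(R e) ^ n` together. -/
theorem projective_peircePart_of_embedding (hinj : Function.Injective s)
    (hs : ∀ r, ∃ b, s b = s 1 * r * s 1) {n : ℕ} (i : M →ₗ[R] Fin n → R)
    (hi : Function.Injective i) (h₁ : ∀ b : Fin n → B, ∃ x, i x = fun j => s (b j))
    (h₂ : ∀ x, s 1 • x = x → ∀ j, i x j * s 1 = i x j) :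
    Module.Projective B (peircePart s M) := by
  choose g hg using h₁
  have hg1 : ∀ b, s 1 • g b = g b := fun b => hi (by
    rw [map_smul, hg]
    ext j
    rw [Pi.smul_apply, smul_eq_mul, ← map_mul, one_mul])
  let φ : (Fin n → B) →ₗ[B] peircePart s M :=
    { toFun := fun b => ⟨g b, hg1 b⟩
      map_add' := fun b c => Subtype.ext (hi (by
        change i (g (b + c)) = i (g b + g c)
        rw [map_add, hg, hg, hg]
        ext j
        simp))
      map_smul' := fun b c => Subtype.ext (hi (by
        change i (g (b • c)) = i (s b • g c)
        rw [map_smul, hg, hg]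
        ext j
        simp)) }
  refine Module.Projective.of_equiv (LinearEquiv.ofBijective φ ⟨?_, ?_⟩)
  · intro b c hbc
    have h : i (g b) = i (g c) := congrArg i (congrArg Subtype.val hbc)
    rw [hg, hg] at h
    exact funext fun j => hinj (congrFun h j)
  · rintro ⟨x, hx⟩
    choose b hb using fun j => hs (i x j)
    refine ⟨b, Subtype.ext (hi ?_)⟩
    change i (g b) = i x
    rw [hg]
    ext j
    rw [hb, mul_assoc, h₂ x hx, ← smul_eq_mul, ← Pi.smul_apply, ← map_smul, hx]

theorem peircePart_split {f : M →ₗ[R] N} [Module.Projective R N] (hf : Function.Surjective f)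
    [Module.Projective B (peircePart s M)] : Module.Projective B (peircePart s N) := by
  obtain ⟨g, hg⟩ := f.exists_rightInverse_of_surjective (LinearMap.range_eq_top.2 hf)
  refine Module.Projective.of_split (peirceMap s g) (peirceMap s f) ?_
  ext m
  exact LinearMap.congr_fun hg _

/-- If `e R e = e R`, then cutting out the part `e • M` does not increase the projective dimension
of a finitely generated module. -/
theorem hasProjectiveDimensionLT_peircePart [IsNoetherianRing R] (hinj : Function.Injective s)
    (hs : ∀ r, ∃ b, s b = s 1 * r * s 1) (hr : ∀ r, s 1 * r * s 1 = s 1 * r) (n : ℕ)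
    (M : Type u) [AddCommGroup M] [Module R M] [Module.Finite R M]
    (h : HasProjectiveDimensionLT (ModuleCat.of R M) (n + 1)) :
    HasProjectiveDimensionLT (ModuleCat.of B (peircePart s M)) (n + 1) := by
  induction n generalizing M with
  | zero =>
    obtain ⟨m, f, hf⟩ := Module.Finite.exists_fin' R M
    have := projective_peircePart_of_embedding s hinj hs (LinearMap.id (M := Fin m → R))
      Function.injective_id (fun b => ⟨_, rfl⟩) (fun x hx j => by
        rw [LinearMap.id_apply, ← hx, Pi.smul_apply, smul_eq_mul, hr])
    rw [zero_add, hasProjectiveDimensionLT_one_iff] at h ⊢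
    exact peircePart_split s hf
  | succ n ih =>
    obtain ⟨m, f, hf⟩ := Module.Finite.exists_fin' R M
    have := projective_peircePart_of_embedding s hinj hs (LinearMap.id (M := Fin m → R))
      Function.injective_id (fun b => ⟨_, rfl⟩) (fun x hx j => by
        rw [LinearMap.id_apply, ← hx, Pi.smul_apply, smul_eq_mul, hr])
    rw [hasProjectiveDimensionLT_iff_ker f hf] at h
    rw [hasProjectiveDimensionLT_iff_ker _ (peirceMap_surjective s f hf)]
    exact hasProjectiveDimensionLT_congr (peirceKer s f).symm _ (ih _ h)

/-- The left module `(R e) ^ n`, where `e = s 1`. -/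
def cornerFree (n : ℕ) : Submodule R (Fin n → R) where
  carrier := {x | ∀ j, x j * s 1 = x j}
  zero_mem' j := zero_mul _
  add_mem' {x y} hx hy j := by rw [Pi.add_apply, add_mul, hx, hy]
  smul_mem' r x hx j := by rw [Pi.smul_apply, smul_eq_mul, mul_assoc, hx]

theorem mul_self_one : s 1 * s 1 = s 1 := by rw [← map_mul, one_mul]

/-- The projection of `R ^ n` onto `(R e) ^ n`. -/
def toCornerFree (n : ℕ) : (Fin n → R) →ₗ[R] cornerFree s n where
  toFun x := ⟨fun j => x j * s 1, fun j => by rw [mul_assoc, mul_self_one]⟩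
  map_add' x y := Subtype.ext (funext fun j => add_mul _ _ _)
  map_smul' r x := Subtype.ext (funext fun j => mul_assoc _ _ _)

instance (n : ℕ) : Module.Projective R (cornerFree s n) :=
  Module.Projective.of_split (cornerFree s n).subtype (toCornerFree s n)
    (LinearMap.ext fun x => Subtype.ext (funext fun j => x.2 j))

theorem projective_peircePart_cornerFree (hinj : Function.Injective s)
    (hs : ∀ r, ∃ b, s b = s 1 * r * s 1) (n : ℕ) :
    Module.Projective B (peircePart s (cornerFree s n)) :=
  projective_peircePart_of_embedding s hinj hs (cornerFree s n).subtype
    (cornerFree s n).injective_subtype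
    (fun b => ⟨⟨fun j => s (b j), fun j => by rw [← map_mul, mul_one]⟩, rfl⟩)
    (fun x _ j => x.2 j)

theorem smul_cornerFree (hl : ∀ r, s 1 * r * s 1 = r * s 1) {n : ℕ} (x : cornerFree s n) :
    s 1 • x = x :=
  Subtype.ext (funext fun j => by
    change s 1 * x.1 j = x.1 j
    rw [← x.2 j, ← mul_assoc, hl])

/-- As `e` is the identity on `M`, a map from `R ^ n` takes the same value on `r` and on `r e`. -/
theorem exists_cornerFree_surjective [Module.Finite R M] (hM : ∀ m : M, s 1 • m = m) :
    ∃ (n : ℕ) (q : cornerFree s n →ₗ[R] M), Function.Surjective q := by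
  obtain ⟨n, f, hf⟩ := Module.Finite.exists_fin' R M
  refine ⟨n, f.comp (cornerFree s n).subtype, fun m => ?_⟩
  obtain ⟨r, rfl⟩ := hf m
  refine ⟨toCornerFree s n r, ?_⟩
  have h : ∀ r, f r = ∑ j, r j • f (Pi.single j 1) := fun r => by
    conv_lhs => rw [pi_eq_sum_univ' r]
    simp [map_sum]
  change f (fun j => r j * s 1) = f r
  rw [h, h r]
  simp only [mul_smul, hM]

/-- If `e R e = R e`, then a finitely generated module `K` with `e • K = K` has the same projective
dimension over `R` and over the corner ring. -/
theorem hasProjectiveDimensionLT_peircePart_iff [IsNoetherianRing R] (hinj : Function.Injective s)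
    (hs : ∀ r, ∃ b, s b = s 1 * r * s 1) (hl : ∀ r, s 1 * r * s 1 = r * s 1) (n : ℕ)
    (M : Type u) [AddCommGroup M] [Module R M] [Module.Finite R M]
    (hM : ∀ m : M, s 1 • m = m) :
    HasProjectiveDimensionLT (ModuleCat.of B (peircePart s M)) (n + 1) ↔
      HasProjectiveDimensionLT (ModuleCat.of R M) (n + 1) := by
  induction n generalizing M with
  | zero =>
    obtain ⟨m, q, hq⟩ := exists_cornerFree_surjective s hM
    have := projective_peircePart_cornerFree s hinj hs m
    rw [zero_add, hasProjectiveDimensionLT_one_iff, hasProjectiveDimensionLT_one_iff]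
    refine ⟨fun h => ?_, fun h => peircePart_split s hq⟩
    obtain ⟨t, ht⟩ := (peirceMap s q).exists_rightInverse_of_surjective
      (LinearMap.range_eq_top.2 (peirceMap_surjective s q hq))
    -- The `B`-linear section is already `R`-linear: `e` is the identity on both modules, so `r`
    -- acts on each as `e r e`.
    let t' : M →ₗ[R] cornerFree s m :=
      { toFun := fun k => (t ⟨k, hM k⟩).1
        map_add' := fun k l => congrArg Subtype.val (map_add t ⟨k, hM k⟩ ⟨l, hM l⟩)
        map_smul' := fun r k => by
          obtain ⟨b, hb⟩ := hs r
          have h₁ : (⟨r • k, hM _⟩ : peircePart s M) = b • ⟨k, hM k⟩ := Subtype.ext (by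
            rw [coe_smul_peircePart, hb, mul_smul, mul_smul, hM, hM])
          rw [h₁, map_smul, coe_smul_peircePart, hb, mul_smul, mul_smul, smul_cornerFree s hl,
            smul_cornerFree s hl, RingHom.id_apply] }
    exact Module.Projective.of_split t' q
      (LinearMap.ext fun k => congrArg Subtype.val (LinearMap.congr_fun ht ⟨k, hM k⟩))
  | succ n ih =>
    obtain ⟨m, q, hq⟩ := exists_cornerFree_surjective s hM
    have := projective_peircePart_cornerFree s hinj hs m
    rw [hasProjectiveDimensionLT_iff_ker q hq,
      hasProjectiveDimensionLT_iff_ker _ (peirceMap_surjective s q hq),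
      ← ih (LinearMap.ker q) fun k => Subtype.ext (smul_cornerFree s hl k.1)]
    exact ⟨hasProjectiveDimensionLT_congr (peirceKer s q) _,
      hasProjectiveDimensionLT_congr (peirceKer s q).symm _⟩

/-- If `e R e = e R` and `e • M` is finitely generated and projective over the corner ring, then
there is a projective module mapping to `M` that agrees with `M` on the parts cut out by `e`. -/
theorem exists_projective_lift (hs : ∀ r, ∃ b, s b = s 1 * r * s 1)
    (hr : ∀ r, s 1 * r * s 1 = s 1 * r)
    [Module.Finite B (peircePart s M)] [Module.Projective B (peircePart s M)] :
    ∃ (n : ℕ) (P : Submodule R (Fin n → R)) (g : P →ₗ[R] M), Module.Projective R P ∧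
      (∀ y, g y = 0 → s 1 • y = 0) ∧ ∀ m : M, s 1 • m = m → ∃ y, g y = m := by
  obtain ⟨n, p, hp⟩ := Module.Finite.exists_fin' B (peircePart s M)
  obtain ⟨t, ht⟩ := p.exists_rightInverse_of_surjective (LinearMap.range_eq_top.2 hp)
  have htp : ∀ x, p (t x) = x := fun x => LinearMap.congr_fun ht x
  have hpsum : ∀ b, p b = ∑ j, b j • p (Pi.single j 1) := fun b => by
    conv_lhs => rw [pi_eq_sum_univ' b]
    simp [map_sum]
  -- The matrix of the idempotent endomorphism `t ∘ p` of `B ^ n`.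
  let c : Fin n → Fin n → B := fun j => t (p (Pi.single j 1))
  let x : Fin n → M := fun j => (p (Pi.single j 1) : peircePart s M).1
  have hpx : ∀ b, (p b : M) = ∑ j, s (b j) • x j := fun b => by
    rw [hpsum, AddSubgroup.val_finsetSum]
    rfl
  have hcx : ∀ j, ∑ k, s (c j k) • x k = x j := fun j => by
    rw [← hpx]
    exact congrArg Subtype.val (htp _)
  have htc : ∀ b k, t (p b) k = ∑ j, b j * c j k := fun b k => by
    rw [hpsum, map_sum, Finset.sum_apply]
    simp only [map_smul, Pi.smul_apply, smul_eq_mul, c]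
  have hcc : ∀ j k, ∑ l, c j l * c l k = c j k := fun j k => by
    rw [← htc, htp]
  -- Right multiplication by the idempotent matrix `s c`. Its range is a concrete model of `R e ⊗ e
  -- M` over the corner ring.
  let E : (Fin n → R) →ₗ[R] (Fin n → R) := Fintype.linearCombination R fun j k => s (c j k)
  have hE : ∀ y k, E y k = ∑ j, y j * s (c j k) := fun y k => by
    simp [E, Fintype.linearCombination_apply, Finset.sum_apply]
  have hEE : ∀ y, E (E y) = E y := fun y => by
    ext k
    simp only [hE, Finset.sum_mul]
    rw [Finset.sum_comm]
    refine Finset.sum_congr rfl fun j _ => ?_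
    simp only [mul_assoc, ← map_mul]
    rw [← Finset.mul_sum, ← map_sum, hcc]
  let G : (Fin n → R) →ₗ[R] M := Fintype.linearCombination R x
  have hG : ∀ y, G y = ∑ j, y j • x j := fun y => Fintype.linearCombination_apply _ _ _
  have hGE : ∀ y, G (E y) = G y := fun y => by
    simp only [hG, hE, Finset.sum_smul]
    rw [Finset.sum_comm]
    refine Finset.sum_congr rfl fun j _ => ?_
    simp only [mul_smul]
    rw [← Finset.smul_sum, hcx]
  refine ⟨n, LinearMap.range E, G.comp (LinearMap.range E).subtype, ?_, ?_, ?_⟩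
  · refine Module.Projective.of_split (LinearMap.range E).subtype E.rangeRestrict ?_
    ext ⟨_, y, rfl⟩ k
    exact congrFun (hEE y) k
  · rintro ⟨_, y, rfl⟩ hy
    change G (E y) = 0 at hy
    -- Since `e y_j = e y_j e` lies in the corner, `e G(y)` is `p b` and `e E(y)` is the image of `t
    -- (p b)`; the first vanishing forces the second to vanish.
    choose b hb using fun j => hs (y j)
    have hb' : ∀ j, s (b j) = s 1 * y j := fun j => by rw [hb, hr]
    have hpb : p b = 0 := Subtype.ext (by
      rw [hpx]
      simp only [hb', mul_smul]
      rw [← Finset.smul_sum, ← hG, ← hGE, hy, smul_zero]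
      rfl)
    refine Subtype.ext (funext fun k => ?_)
    change s 1 * E y k = 0
    rw [hE, Finset.mul_sum]
    simp only [← mul_assoc, ← hb', ← map_mul]
    rw [← map_sum, ← htc, hpb, map_zero, Pi.zero_apply, map_zero]
  · intro m hm
    obtain ⟨b, hb⟩ := hp ⟨m, hm⟩
    refine ⟨⟨E fun j => s (b j), _, rfl⟩, ?_⟩
    change G (E _) = m
    rw [hGE, hG, ← hpx, hb]

end Peirce

/-! ### Finitistic bounds and triangular rings -/

/-- The finitely generated left `R`-modules of finite projective dimension have projective dimension
less than `d`. -/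
def FinitisticBound (R : Type u) [Ring R] (d : ℕ) : Prop :=
  ∀ (M : Type u) [AddCommGroup M] [Module R M] [Module.Finite R M] (n : ℕ),
    HasProjectiveDimensionLT (ModuleCat.of R M) n → HasProjectiveDimensionLT (ModuleCat.of R M) d

theorem finitisticDimension_lt_top_iff (A : Type u) [Ring A] :
    finitisticDimension A < ⊤ ↔ ∃ d, FinitisticBound Aᵐᵒᵖ d := by
  constructor
  · intro h
    obtain ⟨d, hd⟩ : ∃ d : ℕ, finitisticDimension A < d := by
      generalize finitisticDimension A = x at h
      induction x with
      -- The value `⊥` occurs when all these modules are zero, which is what the bound 0 says.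
      | bot => exact ⟨0, WithBot.bot_lt_coe _⟩
      | coe x =>
        induction x with
        | top => exact absurd h (lt_irrefl _)
        | coe n => exact ⟨n + 1, by exact_mod_cast Nat.lt_succ_self n⟩
    refine ⟨d, fun M _ _ hM n hn => ?_⟩
    rw [← projectiveDimension_lt_iff]
    refine lt_of_le_of_lt ?_ hd
    refine le_iSup_of_le (ModuleCat.of Aᵐᵒᵖ M) (le_iSup_of_le hM (le_iSup_of_le ?_ le_rfl))
    rw [projectiveDimension_ne_top_iff]
    exact ⟨n, hasProjectiveDimensionLT_of_ge _ n (n + 1) (Nat.le_succ n)⟩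
  · rintro ⟨d, hd⟩
    refine lt_of_le_of_lt (b := ((d : ℕ) : WithBot ℕ∞)) ?_ ?_
    · refine iSup_le fun M => iSup_le fun hM => iSup_le fun hn => ?_
      rw [projectiveDimension_ne_top_iff] at hn
      obtain ⟨n, hn⟩ := hn
      exact (projectiveDimension_lt_iff.2 (hd M _ hn)).le
    · exact WithBot.coe_lt_coe.2 (ENat.natCast_lt_top d)

section Triangular

variable {B C R : Type u} [Ring B] [Ring C] [Ring R] [IsNoetherianRing R]
  (s : B →ₙ+* R) (t : C →ₙ+* R)

/-- Base case of the triangular bound. One syzygy, taken along a suitable projective cover of both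
parts, lands among the modules fixed by `e = s 1`, where the bound for `B` applies. -/
theorem hasProjectiveDimensionLT_of_projective_peircePart (hst : s 1 + t 1 = 1)
    (hts : ∀ r, t 1 * r * s 1 = 0)
    (hs_inj : Function.Injective s) (hs : ∀ r, ∃ b, s b = s 1 * r * s 1)
    (ht : ∀ r, ∃ c, t c = t 1 * r * t 1) {d : ℕ} (hd : FinitisticBound B d)
    (M : Type u) [AddCommGroup M] [Module R M] [Module.Finite R M]
    [Module.Projective C (peircePart t M)] {n : ℕ}
    (h : HasProjectiveDimensionLT (ModuleCat.of R M) n) :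
    HasProjectiveDimensionLT (ModuleCat.of R M) (d + 2) := by
  have hl : ∀ r, s 1 * r * s 1 = r * s 1 := fun r => by
    rw [← eq_sub_iff_add_eq'] at hst
    rw [← sub_eq_zero, ← neg_eq_zero, ← hts r, hst]
    noncomm_ring
  have hr : ∀ r, t 1 * r * t 1 = t 1 * r := fun r => by
    rw [← eq_sub_iff_add_eq] at hst
    rw [← sub_eq_zero, ← neg_eq_zero, ← hts r, hst]
    noncomm_ring
  have hfin : Module.Finite C (peircePart t M) := finite_peircePart t ht fun r m => by
    rw [smul_smul (t 1) r, ← hr, mul_smul, mul_smul]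
  obtain ⟨m, P, g, hP, hg, hg'⟩ := exists_projective_lift (M := M) t ht hr
  -- The part `e M` is an `R`-submodule because `R e = e R e`.
  let S : Submodule R M :=
    { carrier := {x | s 1 • x = x}
      zero_mem' := smul_zero _
      add_mem' := fun {x y} hx hy => by
        simp only [Set.mem_ofPred_eq] at *
        rw [smul_add, hx, hy]
      smul_mem' := fun r x hx => by
        simp only [Set.mem_ofPred_eq] at *
        rw [← hx, smul_smul r, ← hl, smul_smul, ← mul_assoc, ← mul_assoc, mul_self_one] }
  obtain ⟨l, q, hq⟩ := exists_cornerFree_surjective (M := S) s fun x => Subtype.ext x.2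
  let F : P × cornerFree s l →ₗ[R] M := g.coprod (S.subtype.comp q)
  have hF : Function.Surjective F := fun x => by
    obtain ⟨y, hy⟩ := hg' (t 1 • x) (by rw [smul_smul, mul_self_one])
    obtain ⟨z, hz⟩ := hq ⟨s 1 • x, by
      change s 1 • s 1 • x = s 1 • x
      rw [smul_smul, mul_self_one]⟩
    refine ⟨(y, z), ?_⟩
    simp only [F, LinearMap.coprod_apply, LinearMap.comp_apply, hy, hz, Submodule.subtype_apply]
    rw [add_comm, ← add_smul, hst, one_smul]
  have ht_s : ∀ {X : Type u} [AddCommGroup X] [Module R X] (x : X), s 1 • x = x ↔ t 1 • x = 0 := by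
    intro X _ _ x
    conv_lhs => rw [← sub_eq_zero, ← neg_eq_zero]
    rw [← eq_sub_iff_add_eq'] at hst
    rw [hst, sub_smul, one_smul, neg_sub]
  -- Applying `f = t 1` to an element `(y, z)` of the kernel kills `z` and gives `g (f y) = 0`. As
  -- `g` is injective on `f`-parts, `f y = 0`; so `f` annihilates the kernel.
  have hK : ∀ k : LinearMap.ker F, s 1 • k = k := by
    rintro ⟨⟨y, z⟩, hyz⟩
    have hz := (ht_s z).1 (smul_cornerFree s hl z)
    have h₁ : F (t 1 • (y, z)) = 0 := by
      rw [map_smul, LinearMap.mem_ker.1 hyz, smul_zero]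
    rw [Prod.smul_mk, hz] at h₁
    have h₂ : g (t 1 • y) = 0 := by simpa [F] using h₁
    have h₃ := hg _ h₂
    rw [smul_smul, mul_self_one] at h₃
    have h₄ : t 1 • (y, z) = 0 := by rw [Prod.smul_mk, h₃, hz, Prod.mk_zero_zero]
    exact (ht_s (⟨(y, z), hyz⟩ : LinearMap.ker F)).2 (Subtype.ext h₄)
  have h' : HasProjectiveDimensionLT (ModuleCat.of R M) (n + 2) :=
    hasProjectiveDimensionLT_of_ge _ n _ (by omega)
  rw [hasProjectiveDimensionLT_iff_ker F hF,
    ← hasProjectiveDimensionLT_peircePart_iff s hs_inj hs hl _ _ hK] at h' ⊢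
  have hKfin : Module.Finite B (peircePart s (LinearMap.ker F)) :=
    finite_peircePart s hs fun r k => by rw [hK k]
  have := hd _ _ h'
  exact hasProjectiveDimensionLT_of_ge _ d _ (by omega)

/-- The finitistic dimension of a triangular ring is bounded in terms of those of its two
corners. -/
theorem FinitisticBound.triangular (hst : s 1 + t 1 = 1)
    (hts : ∀ r, t 1 * r * s 1 = 0)
    (hs_inj : Function.Injective s) (hs : ∀ r, ∃ b, s b = s 1 * r * s 1)
    (ht_inj : Function.Injective t) (ht : ∀ r, ∃ c, t c = t 1 * r * t 1)
    {d d' : ℕ} (hd : FinitisticBound B d) (hd' : FinitisticBound C d') :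
    FinitisticBound R (d + d' + 2) := by
  have hr : ∀ r, t 1 * r * t 1 = t 1 * r := fun r => by
    rw [← eq_sub_iff_add_eq] at hst
    rw [← sub_eq_zero, ← neg_eq_zero, ← hts r, hst]
    noncomm_ring
  -- Induction on the projective dimension of `f M`: each syzygy of `M` induces one of `f M`, since
  -- the `f`-part of a free module is projective. The start `k = 0` is the case of `f M` projective.
  have key : ∀ (k : ℕ) (M : Type u) [AddCommGroup M] [Module R M] [Module.Finite R M] (n : ℕ),
      HasProjectiveDimensionLT (ModuleCat.of C (peircePart t M)) (k + 1) →
      HasProjectiveDimensionLT (ModuleCat.of R M) n →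
      HasProjectiveDimensionLT (ModuleCat.of R M) (d + k + 2) := by
    intro k
    induction k with
    | zero =>
      intro M _ _ _ n hM hn
      rw [zero_add, hasProjectiveDimensionLT_one_iff] at hM
      exact hasProjectiveDimensionLT_of_projective_peircePart s t hst hts hs_inj hs ht hd M hn
    | succ k ih =>
      intro M _ _ _ n hM hn
      obtain ⟨m, f, hf⟩ := Module.Finite.exists_fin' R M
      have : Module.Projective C (peircePart t (Fin m → R)) :=
        hasProjectiveDimensionLT_one_iff.1 (hasProjectiveDimensionLT_peircePart t ht_inj ht hr 0 _
          (hasProjectiveDimensionLT_one_iff.2 inferInstance))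
      have hn' : HasProjectiveDimensionLT (ModuleCat.of R M) (n + 2) :=
        hasProjectiveDimensionLT_of_ge _ n _ (by omega)
      rw [hasProjectiveDimensionLT_iff_ker _ (peirceMap_surjective t f hf)] at hM
      rw [hasProjectiveDimensionLT_iff_ker f hf] at hn'
      rw [hasProjectiveDimensionLT_iff_ker f hf]
      exact ih _ _ (hasProjectiveDimensionLT_congr (peirceKer t f) _ hM) hn'
  intro M _ _ _ n hn
  have hfin : Module.Finite C (peircePart t M) := finite_peircePart t ht fun r m => by
    rw [smul_smul (t 1) r, ← hr, mul_smul, mul_smul]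
  have h₁ : HasProjectiveDimensionLT (ModuleCat.of R M) (n + 1) :=
    hasProjectiveDimensionLT_of_ge _ n _ (by omega)
  have h₂ := hd' _ _ (hasProjectiveDimensionLT_peircePart t ht_inj ht hr n M h₁)
  exact key d' M n (hasProjectiveDimensionLT_of_ge _ d' _ (by omega)) hn

end Triangular

/-! ### Full subquivers and their paths -/

/-- The vertices of the full subquiver on the vertices satisfying a predicate. -/
@[ext]
structure FullSubquiver {V : Type v} (U : V → Prop) : Type v where
  /-- The underlying vertex. -/
  vertex : V
  mem : U vertex

namespace FullSubquiver

theorem vertex_injective {V : Type v} (U : V → Prop) :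
    Function.Injective (vertex : FullSubquiver U → V) :=
  fun _ _ h => FullSubquiver.ext h

theorem card_lt {V : Type v} [Fintype V] (U : V → Prop) [Fintype (FullSubquiver U)]
    {a : V} (ha : ¬ U a) :
    Fintype.card (FullSubquiver U) < Fintype.card V :=
  Fintype.card_lt_of_injective_of_notMem _ (vertex_injective U) (b := a)
    (by rintro ⟨x, rfl⟩; exact ha x.mem)

variable {V : Type v} [Quiver.{w} V] (U : V → Prop)

instance : Quiver.{w} (FullSubquiver U) := ⟨fun a b => a.vertex ⟶ b.vertex⟩

instance [Fintype V] : Fintype (FullSubquiver U) :=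
  haveI : Finite (FullSubquiver U) := Finite.of_injective _ (vertex_injective U)
  Fintype.ofFinite _

instance [h : ∀ a b : V, Finite (a ⟶ b)] (a b : FullSubquiver U) : Finite (a ⟶ b) :=
  h a.vertex b.vertex

/-- The inclusion of a full subquiver. -/
def incl : FullSubquiver U ⥤q V where
  obj a := a.vertex
  map e := e

theorem length_mapPath_incl {a b : FullSubquiver U} (p : Path a b) :
    ((incl U).mapPath p).length = p.length := by
  induction p with
  | nil => rfl
  | cons p e ih => simp [Prefunctor.mapPath_cons, ih]

theorem mapPath_incl_injective {a b : FullSubquiver U} {p q : Path a b}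
    (h : (incl U).mapPath p = (incl U).mapPath q) : p = q := by
  induction p with
  | nil =>
    cases q with
    | nil => rfl
    | cons q e =>
      have := congrArg Path.length h
      simp at this
  | cons p e ih =>
    cases q with
    | nil =>
      have := congrArg Path.length h
      simp at this
    | cons q e' =>
      rw [Prefunctor.mapPath_cons, Prefunctor.mapPath_cons] at h
      obtain rfl := vertex_injective U (Path.obj_eq_of_cons_eq_cons h)
      have h₂ := eq_of_heq (Path.heq_of_cons_eq_cons h)
      have h₃ : (incl U).map e = (incl U).map e' := eq_of_heq (Path.hom_heq_of_cons_eq_cons h)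
      obtain rfl : e = e' := h₃
      rw [ih h₂]

/-- The path of the whole quiver underlying a path of a full subquiver. -/
def totalIncl (p : TotalPath (FullSubquiver U)) : TotalPath V :=
  ⟨p.1.vertex, p.2.1.vertex, (incl U).mapPath p.2.2⟩

theorem totalIncl_injective : Function.Injective (totalIncl U) := by
  rintro ⟨⟨a, ha⟩, ⟨b, hb⟩, p⟩ ⟨⟨a', ha'⟩, ⟨b', hb'⟩, q⟩ h
  obtain rfl : a = a' := congrArg Sigma.fst h
  have h₁ := eq_of_heq (Sigma.mk.inj h).2
  obtain rfl : b = b' := congrArg Sigma.fst h₁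
  obtain rfl : p = q := mapPath_incl_injective U (eq_of_heq (Sigma.mk.inj h₁).2)
  rfl

/-- Here `hU` is convexity: a path between vertices of `U` never leaves `U`. Successor-closed sets
and their complements are both convex. -/
theorem exists_mapPath_incl (hU : ∀ {a b c : V}, Path a b → Path b c → U a → U c → U b)
    {a b : V} (p : Path a b) (ha : U a) (hb : U b) :
    ∃ q : Path (FullSubquiver.mk (U := U) a ha) (FullSubquiver.mk (U := U) b hb),
      (incl U).mapPath q = p := by
  induction p with
  | nil => exact ⟨Path.nil, rfl⟩
  | @cons b c p e ih =>
    obtain ⟨q, hq⟩ := ih (hU p e.toPath ha hb)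
    exact ⟨q.cons (show FullSubquiver.mk (U := U) b _ ⟶ FullSubquiver.mk (U := U) c hb from e),
      congrArg (Path.cons · e) hq⟩

end FullSubquiver

open FullSubquiver

/-- A nontrivial path is a shorter path followed by one of finitely many arrows. -/
theorem Quiver.finite_totalPath_length_lt (V : Type v) [Quiver.{w} V] [Finite V]
    [∀ a b : V, Finite (a ⟶ b)] (n : ℕ) : {p : TotalPath V | p.2.2.length < n}.Finite := by
  induction n with
  | zero => simp
  | succ n ih =>
    have := ih.to_subtype
    refine ((Set.finite_range fun a : V => (⟨a, a, Path.nil⟩ : TotalPath V)).union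
      (Set.finite_range fun x : (Σ (p : {p : TotalPath V | p.2.2.length < n}) (c : V),
        p.1.2.1 ⟶ c) => (⟨x.1.1.1, x.2.1, x.1.1.2.2.cons x.2.2⟩ : TotalPath V))).subset ?_
    rintro ⟨a, b, p⟩ hp
    cases p with
    | nil => exact Or.inl ⟨a, rfl⟩
    | @cons b' _ p e =>
      refine Or.inr ⟨⟨⟨⟨a, b', p⟩, ?_⟩, b, e⟩, rfl⟩
      simpa using hp

namespace PathAlgebra

variable (K : Type u) [Field K] {V : Type v} [Quiver.{w} V]

/-! ### The filtration of the path algebra by length -/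

section Filtration

variable (V) in
/-- The span of the paths of length at least `k`. -/
def longPaths (k : ℕ) : Submodule K (PathAlgebra K V) :=
  Submodule.span K ((fun p : TotalPath V => ofPath K p.2.2) '' {p | k ≤ p.2.2.length})

variable {K}

/-- Paths form a basis, so membership is read off coefficients; this lets it be tested after
inclusion into a larger quiver. -/
theorem mem_longPaths_iff {k : ℕ} {x : PathAlgebra K V} :
    x ∈ longPaths K V k ↔ ∀ p : TotalPath V, (show TotalPath V →₀ K from x) p ≠ 0 →
      k ≤ p.2.2.length := by
  have h : longPaths K V k = Finsupp.supported K K {p : TotalPath V | k ≤ p.2.2.length} :=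
    (Finsupp.supported_eq_span_single K _).symm
  rw [h]
  refine (Finsupp.mem_supported K _).trans ⟨fun h p hp => h (Finsupp.mem_support_iff.2 hp),
    fun h p hp => h p (Finsupp.mem_support_iff.1 hp)⟩

theorem ofPath_mem_longPaths {a b : V} (p : Path a b) {k : ℕ} (h : k ≤ p.length) :
    ofPath K p ∈ longPaths K V k := Submodule.subset_span ⟨⟨a, b, p⟩, h, rfl⟩

theorem longPaths_zero : longPaths K V 0 = ⊤ :=
  top_unique fun _ _ => mem_longPaths_iff.2 fun _ _ => Nat.zero_le _

variable [Fintype V]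

theorem mul_mem_longPaths {i j : ℕ} {x y : PathAlgebra K V} (hx : x ∈ longPaths K V i)
    (hy : y ∈ longPaths K V j) : x * y ∈ longPaths K V (i + j) := by
  have h : longPaths K V i * longPaths K V j ≤ longPaths K V (i + j) := by
    rw [longPaths, longPaths, Submodule.span_mul_span, Submodule.span_le]
    rintro _ ⟨_, ⟨⟨a, b, p⟩, hp, rfl⟩, _, ⟨⟨c, d, q⟩, hq, rfl⟩, rfl⟩
    simp only [Set.mem_ofPred_eq] at hp hq
    by_cases hbc : b = c
    · subst hbc
      simp only [ofPath_mul_ofPath]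
      refine ofPath_mem_longPaths _ ?_
      rw [Path.length_comp]
      omega
    · simp only [ofPath_mul_ofPath_of_ne K p q hbc]
      exact Submodule.zero_mem _
  exact h (Submodule.mul_mem_mul hx hy)

theorem mem_arrowIdeal_one {x : PathAlgebra K V} (h : x ∈ arrowIdeal K V) :
    x ∈ longPaths K V 1 := by
  -- The paths of positive length span a two-sided ideal, since multiplying by any path never
  -- shortens them, and it contains the arrows.
  let T : TwoSidedIdeal (PathAlgebra K V) := TwoSidedIdeal.mk' (longPaths K V 1 : Set _)
    (Submodule.zero_mem _) (Submodule.add_mem _) (Submodule.neg_mem _)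
    (@fun x y hy => by
      have := mul_mem_longPaths (i := 0) (x := x)
        (by rw [longPaths_zero]; exact Submodule.mem_top) hy
      rwa [zero_add] at this)
    (@fun x y hx => by
      have := mul_mem_longPaths (j := 0) (y := y) hx
        (by rw [longPaths_zero]; exact Submodule.mem_top)
      rwa [add_zero] at this)
  have hT : ∀ y, y ∈ T ↔ y ∈ longPaths K V 1 := fun y => TwoSidedIdeal.mem_mk' _ _ _ _ _ _ y
  rw [← hT]
  refine TwoSidedIdeal.span_le.2 ?_ (TwoSidedIdeal.mem_asIdeal.1 h)
  rintro _ ⟨a, b, e, rfl⟩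
  exact (hT _).2 (ofPath_mem_longPaths _ le_rfl)

/-- The powers of the arrow ideal are the spans of the long paths. -/
theorem mem_arrowIdeal_pow_iff {k : ℕ} {x : PathAlgebra K V} :
    x ∈ arrowIdeal K V ^ k ↔ x ∈ longPaths K V k := by
  constructor
  · intro h
    induction k generalizing x with
    | zero => simp [longPaths_zero]
    | succ k ih =>
      rw [Submodule.pow_succ] at h
      induction h using Submodule.mul_induction_on' with
      | mem_mul_mem r hr n hn => exact mul_mem_longPaths (ih hr) (mem_arrowIdeal_one hn)
      | add x _ y _ hx hy => exact Submodule.add_mem _ hx hy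
  · intro h
    have hp : ∀ (k : ℕ) {a b : V} (p : Path a b), k ≤ p.length →
        ofPath K p ∈ arrowIdeal K V ^ k := by
      intro k
      induction k with
      | zero =>
        intro a b p _
        rw [Submodule.pow_zero, Submodule.one_eq_span]
        exact Ideal.mem_span_singleton'.2 ⟨_, mul_one _⟩
      | succ k ih =>
        intro a b p hk
        cases p with
        | nil => simp at hk
        | cons p e =>
          have he : ofPath K (p.cons e) = ofPath K p * ofPath K e.toPath :=
            (ofPath_mul_ofPath K p e.toPath).symm
          rw [he, Submodule.pow_succ]
          refine Submodule.mul_mem_mul (ih p (by simpa using hk)) ?_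
          exact TwoSidedIdeal.mem_asIdeal.2 (TwoSidedIdeal.subset_span ⟨_, _, e, rfl⟩)
    have hle : longPaths K V k ≤ (arrowIdeal K V ^ k).restrictScalars K := by
      rw [longPaths, Submodule.span_le]
      rintro _ ⟨p, hpk, rfl⟩
      exact hp k _ hpk
    exact hle h

/-- The quotient of the path algebra of a finite quiver by an admissible ideal is
finite-dimensional. -/
theorem finite_quotient [∀ a b : V, Finite (a ⟶ b)] (I : Ideal (PathAlgebra K V)) [I.IsTwoSided]
    (hI : IsAdmissible I) : Module.Finite K (PathAlgebra K V ⧸ I) := by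
  obtain ⟨n, -, hn, -⟩ := hI
  have hfin := (Quiver.finite_totalPath_length_lt V n).image
    fun p => Ideal.Quotient.mk I (ofPath K p.2.2)
  refine Module.Finite.of_fg_top ⟨hfin.toFinset, top_unique ?_⟩
  rintro x -
  obtain ⟨x, rfl⟩ := Ideal.Quotient.mk_surjective x
  rw [Set.Finite.coe_toFinset]
  induction x using PathAlgebra.induction with
  | zero => rw [map_zero]; exact Submodule.zero_mem _
  | add x y hx hy => rw [map_add]; exact Submodule.add_mem _ hx hy
  | smul k a b p =>
    have h₁ : Ideal.Quotient.mk I (k • ofPath K p) = k • Ideal.Quotient.mk I (ofPath K p) := rfl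
    rw [h₁]
    refine Submodule.smul_mem _ _ ?_
    by_cases hp : p.length < n
    · exact Submodule.subset_span ⟨⟨a, b, p⟩, hp, rfl⟩
    · rw [Ideal.Quotient.eq_zero_iff_mem.2
        (hn (mem_arrowIdeal_pow_iff.2 (ofPath_mem_longPaths p (not_lt.1 hp))))]
      exact Submodule.zero_mem _

end Filtration

/-! ### Path algebras of full subquivers as corners -/

section Subquiver

variable [Fintype V] (U : V → Prop)

/-- The inclusion of the path algebra of a full subquiver. It is multiplicative, but need not
preserve the identity. -/
def inclusion : PathAlgebra K (FullSubquiver U) →ₗ[K] PathAlgebra K V :=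
  Finsupp.lmapDomain K K (totalIncl U)

theorem inclusion_ofPath {a b : FullSubquiver U} (p : Path a b) :
    inclusion K U (ofPath K p) = ofPath K ((incl U).mapPath p) :=
  Finsupp.mapDomain_single

theorem inclusion_mul (x y : PathAlgebra K (FullSubquiver U)) :
    inclusion K U (x * y) = inclusion K U x * inclusion K U y := by
  induction x using PathAlgebra.induction with
  | zero => simp
  | add x x' hx hx' => rw [add_mul, map_add, map_add, add_mul, hx, hx']
  | smul k a b p =>
  induction y using PathAlgebra.induction with
  | zero => simp
  | add y y' hy hy' => rw [mul_add, map_add, map_add, mul_add, hy, hy']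
  | smul l c d q =>
  simp only [smul_mul, mul_smul', map_smul, inclusion_ofPath]
  congr 2
  by_cases h : b = c
  · subst h
    rw [ofPath_mul_ofPath, ofPath_mul_ofPath, inclusion_ofPath, Prefunctor.mapPath_comp]
  · rw [ofPath_mul_ofPath_of_ne K _ _ h, map_zero]
    exact (ofPath_mul_ofPath_of_ne K _ _ fun h' => h (FullSubquiver.ext h')).symm

/-- The inclusion sends distinct paths to distinct paths of the same length. -/
theorem inclusion_mem_longPaths_iff {k : ℕ} {x : PathAlgebra K (FullSubquiver U)} :
    inclusion K U x ∈ longPaths K V k ↔ x ∈ longPaths K (FullSubquiver U) k := by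
  constructor
  · rw [mem_longPaths_iff, mem_longPaths_iff]
    intro h p hp
    rw [← length_mapPath_incl]
    refine h (totalIncl U p) ?_
    have h₁ : (show TotalPath V →₀ K from inclusion K U x) (totalIncl U p) =
        (show TotalPath (FullSubquiver U) →₀ K from x) p :=
      Finsupp.mapDomain_apply (totalIncl_injective U) _ _
    rwa [h₁]
  · intro h
    have hle : longPaths K (FullSubquiver U) k ≤ (longPaths K V k).comap (inclusion K U) := by
      rw [longPaths, Submodule.span_le]
      rintro _ ⟨p, hp, rfl⟩
      change inclusion K U (ofPath K p.2.2) ∈ longPaths K V k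
      rw [inclusion_ofPath]
      exact ofPath_mem_longPaths ((incl U).mapPath p.2.2) (by rwa [length_mapPath_incl])
    exact hle h

theorem inclusion_one_mul_ofPath [DecidablePred U] {a b : V} (p : Path a b) :
    inclusion K U 1 * ofPath K p = if U a then ofPath K p else 0 := by
  rw [one_def, map_sum, Finset.sum_mul]
  simp only [inclusion_ofPath]
  split_ifs with ha
  · rw [Finset.sum_eq_single (FullSubquiver.mk a ha)]
    · exact (ofPath_mul_ofPath K (Path.nil : Path a a) p).trans (by rw [Path.nil_comp])
    · intro c _ hc
      exact ofPath_mul_ofPath_of_ne K _ p fun h => hc (FullSubquiver.ext h)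
    · simp
  · exact Finset.sum_eq_zero fun c _ =>
      ofPath_mul_ofPath_of_ne K _ p fun h => ha (h ▸ c.mem)

theorem ofPath_mul_inclusion_one [DecidablePred U] {a b : V} (p : Path a b) :
    ofPath K p * inclusion K U 1 = if U b then ofPath K p else 0 := by
  rw [one_def, map_sum, Finset.mul_sum]
  simp only [inclusion_ofPath]
  split_ifs with hb
  · rw [Finset.sum_eq_single (FullSubquiver.mk b hb)]
    · exact (ofPath_mul_ofPath K p (Path.nil : Path b b)).trans (by rw [Path.comp_nil])
    · intro c _ hc
      exact ofPath_mul_ofPath_of_ne K p _ fun h => hc (FullSubquiver.ext h.symm)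
    · simp
  · exact Finset.sum_eq_zero fun c _ =>
      ofPath_mul_ofPath_of_ne K p _ fun h => hb (h ▸ c.mem)

open Classical in
theorem exists_inclusion_eq (hU : ∀ {a b c : V}, Path a b → Path b c → U a → U c → U b)
    (x : PathAlgebra K V) : ∃ y, inclusion K U y = inclusion K U 1 * x * inclusion K U 1 := by
  induction x using PathAlgebra.induction with
  | zero => exact ⟨0, by simp⟩
  | add x x' hx hx' =>
    obtain ⟨y, hy⟩ := hx
    obtain ⟨y', hy'⟩ := hx'
    exact ⟨y + y', by rw [map_add, hy, hy', mul_add, add_mul]⟩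
  | smul k a b p =>
    rw [mul_smul', smul_mul, inclusion_one_mul_ofPath]
    by_cases ha : U a
    · rw [if_pos ha, ofPath_mul_inclusion_one]
      by_cases hb : U b
      · obtain ⟨q, hq⟩ := exists_mapPath_incl U hU p ha hb
        exact ⟨k • ofPath K q, by
          rw [if_pos hb, map_smul, inclusion_ofPath, hq]
          rfl⟩
      · exact ⟨0, by simp [hb]⟩
    · exact ⟨0, by simp [ha]⟩

open Classical in
theorem inclusion_one_add_inclusion_one_not :
    inclusion K U 1 + inclusion K (fun x => ¬ U x) 1 = (1 : PathAlgebra K V) := by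
  rw [← mul_one (inclusion K U 1), ← mul_one (inclusion K (fun x => ¬ U x) 1)]
  rw [one_def K (V := V), Finset.mul_sum, Finset.mul_sum, ← Finset.sum_add_distrib]
  refine Finset.sum_congr rfl fun a _ => ?_
  rw [inclusion_one_mul_ofPath, inclusion_one_mul_ofPath]
  by_cases h : U a <;> simp [h]

-- The triangular shape: a path starting in the successor-closed set `U` cannot end outside it.
open Classical in
theorem inclusion_one_mul_mul_inclusion_one_not (hU : ∀ {a b : V}, Path a b → U a → U b)
    (x : PathAlgebra K V) :
    inclusion K U 1 * x * inclusion K (fun x => ¬ U x) 1 = 0 := by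
  induction x using PathAlgebra.induction with
  | zero => simp
  | add x y hx hy => rw [mul_add, add_mul, hx, hy, add_zero]
  | smul k a b p =>
    rw [mul_smul', smul_mul, inclusion_one_mul_ofPath]
    by_cases ha : U a
    · rw [if_pos ha, ofPath_mul_inclusion_one, if_neg (not_not.2 (hU p ha)), smul_zero]
    · rw [if_neg ha, zero_mul, smul_zero]

variable {K} (I : Ideal (PathAlgebra K V))

/-- The intersection of an ideal with the path algebra of a full subquiver. -/
def restrictIdeal : Ideal (PathAlgebra K (FullSubquiver U)) where
  carrier := {x | inclusion K U x ∈ I}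
  zero_mem' := by
    rw [Set.mem_ofPred_eq, map_zero]
    exact I.zero_mem
  add_mem' {x y} hx hy := by
    rw [Set.mem_ofPred_eq, map_add]
    exact I.add_mem hx hy
  smul_mem' r x hx := by
    rw [Set.mem_ofPred_eq, smul_eq_mul, inclusion_mul]
    exact I.mul_mem_left _ hx

theorem mem_restrictIdeal {x : PathAlgebra K (FullSubquiver U)} :
    x ∈ restrictIdeal U I ↔ inclusion K U x ∈ I := Iff.rfl

instance [I.IsTwoSided] : (restrictIdeal U I).IsTwoSided where
  mul_mem_of_left {x} y hx := by
    rw [mem_restrictIdeal, inclusion_mul]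
    exact I.mul_mem_right _ hx

/-- The same exponent works: inclusion preserves length for the lower containment and reflects it
for the upper one. -/
theorem isAdmissible_restrictIdeal (hI : IsAdmissible I) : IsAdmissible (restrictIdeal U I) := by
  obtain ⟨n, hn, h₁, h₂⟩ := hI
  refine ⟨n, hn, fun x hx => h₁ ?_, fun x hx => ?_⟩
  · rw [mem_arrowIdeal_pow_iff] at hx ⊢
    exact (inclusion_mem_longPaths_iff K U).2 hx
  · have := h₂ hx
    rw [mem_arrowIdeal_pow_iff] at this ⊢
    exact (inclusion_mem_longPaths_iff K U).1 this

variable [I.IsTwoSided]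

/-- The map need not preserve 1, so it is built from chosen representatives; independence of the
choice is the definition of the restricted ideal. -/
theorem exists_quotientInclusion :
    ∃ s : (PathAlgebra K (FullSubquiver U) ⧸ restrictIdeal U I) →ₙ+* (PathAlgebra K V ⧸ I),
      ∀ x, s (Ideal.Quotient.mk _ x) = Ideal.Quotient.mk I (inclusion K U x) := by
  let g : (PathAlgebra K (FullSubquiver U) ⧸ restrictIdeal U I) → (PathAlgebra K V ⧸ I) :=
    fun x => Ideal.Quotient.mk I (inclusion K U (Function.surjInv Ideal.Quotient.mk_surjective x))
  have hg : ∀ x, g (Ideal.Quotient.mk _ x) = Ideal.Quotient.mk I (inclusion K U x) := fun x => by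
    rw [Ideal.Quotient.mk_eq_mk_iff_sub_mem, ← map_sub, ← mem_restrictIdeal,
      ← Ideal.Quotient.mk_eq_mk_iff_sub_mem]
    exact Function.surjInv_eq _ _
  refine ⟨⟨⟨g, ?_⟩, ?_, ?_⟩, hg⟩
  · intro x y
    obtain ⟨x, rfl⟩ := Ideal.Quotient.mk_surjective x
    obtain ⟨y, rfl⟩ := Ideal.Quotient.mk_surjective y
    rw [← map_mul, hg, hg, hg, inclusion_mul, map_mul]
  · change g 0 = 0
    rw [← map_zero (Ideal.Quotient.mk _), hg, map_zero, map_zero]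
  · intro x y
    obtain ⟨x, rfl⟩ := Ideal.Quotient.mk_surjective x
    obtain ⟨y, rfl⟩ := Ideal.Quotient.mk_surjective y
    change g _ = g _ + g _
    rw [← map_add, hg, hg, hg, map_add, map_add]

/-- The inclusion of the bound path algebra of a full subquiver. -/
def quotientInclusion :
    (PathAlgebra K (FullSubquiver U) ⧸ restrictIdeal U I) →ₙ+* (PathAlgebra K V ⧸ I) :=
  (exists_quotientInclusion U I).choose

theorem quotientInclusion_mk (x : PathAlgebra K (FullSubquiver U)) :
    quotientInclusion U I (Ideal.Quotient.mk _ x) = Ideal.Quotient.mk I (inclusion K U x) :=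
  (exists_quotientInclusion U I).choose_spec x

theorem quotientInclusion_one :
    quotientInclusion U I 1 = Ideal.Quotient.mk I (inclusion K U 1) := by
  rw [← quotientInclusion_mk, map_one (Ideal.Quotient.mk (restrictIdeal U I))]

theorem quotientInclusion_injective : Function.Injective (quotientInclusion U I) := by
  rw [injective_iff_map_eq_zero]
  intro x hx
  obtain ⟨x, rfl⟩ := Ideal.Quotient.mk_surjective x
  rw [quotientInclusion_mk, Ideal.Quotient.eq_zero_iff_mem] at hx
  exact Ideal.Quotient.eq_zero_iff_mem.2 hx

theorem exists_quotientInclusion_eq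
    (hU : ∀ {a b c : V}, Path a b → Path b c → U a → U c → U b) (x : PathAlgebra K V ⧸ I) :
    ∃ y, quotientInclusion U I y = quotientInclusion U I 1 * x * quotientInclusion U I 1 := by
  obtain ⟨x, rfl⟩ := Ideal.Quotient.mk_surjective x
  obtain ⟨y, hy⟩ := exists_inclusion_eq K U hU x
  exact ⟨Ideal.Quotient.mk _ y, by
    rw [quotientInclusion_mk, quotientInclusion_one, hy, map_mul, map_mul]⟩

/-- Finiteness of the finitistic dimension can be checked on a successor-closed set of vertices and
on its complement. -/
theorem finitisticDimension_lt_top_of_subquivers [∀ a b : V, Finite (a ⟶ b)]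
    (hI : IsAdmissible I) (hU : ∀ {a b : V}, Path a b → U a → U b)
    (h₁ : finitisticDimension (PathAlgebra K (FullSubquiver U) ⧸ restrictIdeal U I) < ⊤)
    (h₂ : finitisticDimension (PathAlgebra K (FullSubquiver fun x => ¬ U x) ⧸
      restrictIdeal (fun x => ¬ U x) I) < ⊤) :
    finitisticDimension (PathAlgebra K V ⧸ I) < ⊤ := by
  rw [finitisticDimension_lt_top_iff] at h₁ h₂ ⊢
  obtain ⟨d, hd⟩ := h₁
  obtain ⟨d', hd'⟩ := h₂
  have := finite_quotient I hI
  -- Finite dimension over `K` makes the ring Noetherian, which keeps all syzygies finitely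
  -- generated.
  have : IsNoetherianRing (PathAlgebra K V ⧸ I)ᵐᵒᵖ :=
    have : Module.Finite K (PathAlgebra K V ⧸ I)ᵐᵒᵖ :=
      Module.Finite.equiv (MulOpposite.opLinearEquiv K)
    isNoetherian_of_tower K inferInstance
  have hcorner : ∀ (W : V → Prop),
      (∀ {a b c : V}, Path a b → Path b c → W a → W c → W b) →
      ∀ r, ∃ b, NonUnitalRingHom.op (quotientInclusion W I) b =
        NonUnitalRingHom.op (quotientInclusion W I) 1 * r *
          NonUnitalRingHom.op (quotientInclusion W I) 1 := fun W hW r => by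
    obtain ⟨y, hy⟩ := exists_quotientInclusion_eq W I hW r.unop
    exact ⟨MulOpposite.op y, MulOpposite.unop_injective (hy.trans (mul_assoc _ _ _))⟩
  have hinj : ∀ W : V → Prop,
      Function.Injective (NonUnitalRingHom.op (quotientInclusion W I)) := fun W x y hxy =>
    MulOpposite.unop_injective (quotientInclusion_injective W I (MulOpposite.op_injective hxy))
  refine ⟨_, FinitisticBound.triangular (NonUnitalRingHom.op (quotientInclusion U I))
    (NonUnitalRingHom.op (quotientInclusion (fun x => ¬ U x) I)) ?_ ?_
    (hinj _) (hcorner _ fun p _ ha _ => hU p ha) (hinj _)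
    (hcorner _ fun _ q _ hc hb => hc (hU q hb)) hd hd'⟩
  · refine MulOpposite.unop_injective ?_
    change quotientInclusion U I 1 + quotientInclusion _ I 1 = 1
    rw [quotientInclusion_one, quotientInclusion_one, ← map_add,
      inclusion_one_add_inclusion_one_not, map_one]
  · intro r
    refine MulOpposite.unop_injective ?_
    -- Passing to the opposite ring reverses products, so the required vanishing is that of paths
    -- from `U` to its complement.
    change quotientInclusion U I 1 * (r.unop * quotientInclusion _ I 1) = 0
    obtain ⟨x, hx⟩ := Ideal.Quotient.mk_surjective r.unop
    rw [quotientInclusion_one, quotientInclusion_one, ← hx, ← map_mul, ← map_mul, ← mul_assoc,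
      inclusion_one_mul_mul_inclusion_one_not K U hU, map_zero]

end Subquiver

end PathAlgebra

end

/-! ### Induction on the number of vertices -/

theorem theorem6p1 (K : Type u) [Field K]
    (h : ∀ (V : Type v) [Quiver.{w} V] [Fintype V] [∀ a b : V, Finite (a ⟶ b)]
      (I : Ideal (PathAlgebra K V)) [I.IsTwoSided],
      Quiver.IsStronglyConnected V → PathAlgebra.IsAdmissible I →
        finitisticDimension (PathAlgebra K V ⧸ I) < ⊤)
    (V : Type v) [Quiver.{w} V] [Fintype V] [∀ a b : V, Finite (a ⟶ b)]
    (I : Ideal (PathAlgebra K V)) [I.IsTwoSided] (hI : PathAlgebra.IsAdmissible I) :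
    finitisticDimension (PathAlgebra K V ⧸ I) < ⊤ := by
  induction hn : Fintype.card V using Nat.strong_induction_on generalizing V with
  | _ n ih =>
    by_cases hV : Quiver.IsStronglyConnected V
    · exact h V I hV hI
    · simp only [Quiver.isStronglyConnected_iff, not_forall] at hV
      obtain ⟨a, b, hab⟩ := hV
      subst hn
      -- The vertices reachable from `a` omit `b`, and their complement omits `a` because of the
      -- trivial path; both subquivers are therefore smaller.
      refine PathAlgebra.finitisticDimension_lt_top_of_subquivers (fun x => Nonempty (Path a x)) I
        hI (fun p ⟨q⟩ => ⟨q.comp p⟩) ?_ ?_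
      · exact ih _ (FullSubquiver.card_lt _ hab) _ _
          (PathAlgebra.isAdmissible_restrictIdeal _ I hI) rfl
      · exact ih _ (FullSubquiver.card_lt _ (not_not.2 ⟨Path.nil⟩)) _ _
          (PathAlgebra.isAdmissible_restrictIdeal _ I hI) rfl
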